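/- Let $A$ be a unital Banach algebra over $\mathbb R$ or $\mathbb C$ (with $\|ab\|\le\|a\|\,\|b\|$). Banach $A$-modules are unital left Banach modules with $\|a\cdot x\|\le\|a\|\,\|x\|$, and morphisms are bounded $A$-linear maps. A contractive monomorphism is an injective morphism of norm at most $1$. A contractive monomorphism $\alpha\colon Y\to X$ is called maximal if it is not surjective and, for every non-surjective contractive monomorphism $\beta\colon Z\to X$ and every contractive morphism $\kappa\colon Y\to Z$, the equality $\alpha=\beta\kappa$ implies that $\kappa$ is an isometric isomorphism. A morphism $\psi\colon X_0\to X$ is called small if every morphism $\varphi\colon Y\to X$ for which $Y\oplus X_0\to X$, $(y,z)\mapsto\varphi(y)+\psi(z)$, is surjective is itself surjective. The topological radical $\operatorname{trad}X$ is the intersection of the ranges of all maximal contractive monomorphisms into $X$ or, equivalently, the union of the ranges of all small morphisms into $X$ (an empty intersection being $X$). The algebraic radical $\operatorname{rad}X$ is the intersection of all (not necessarily closed) maximal proper submodules of $X$, and $\operatorname{Rad}A$ is the Jacobson radical of $A$, i.e. the intersection of all maximal left ideals. Let $X$ be a Banach $A$-module that is finitely generated, i.e. $X=A\cdot x_1+\dots+A\cdot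 x_n$ for some $x_1,\dots,x_n\in X$. Then: (1) every algebraically maximal (i.e. maximal proper) submodule of $X$ is closed; (2) $\operatorname{trad}X=\operatorname{rad}X$, for both descriptions of $\operatorname{trad}X$. In particular, for $A$ regarded as a left Banach module over itself, $\operatorname{trad}A=\operatorname{Rad}A$, again for both descriptions. -/

import Mathlib

universe u v w

namespace BanachModule

/-- A morphism of Banach modules (a continuous `A`-linear map) is contractive if its norm
is at most one. -/
def IsContractive {A : Type u} [NormedRing A] {Y : Type w} [NormedAddCommGroup Y] [Module A Y]
    {X : Type v} [NormedAddCommGroup X] [Module A X] (f : Y →L[A] X) : Prop :=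
  ∀ y : Y, ‖f y‖ ≤ ‖y‖

/-- A contractive monomorphism is an injective contractive morphism. -/
def IsContractiveMono {A : Type u} [NormedRing A] {Y : Type w} [NormedAddCommGroup Y]
    [Module A Y] {X : Type v} [NormedAddCommGroup X] [Module A X] (f : Y →L[A] X) : Prop :=
  IsContractive f ∧ Function.Injective f

/-- A contractive monomorphism `α : Y → X` is maximal if it is not surjective and for all
non-surjective contractive monomorphisms `β : Z → X` and all contractive `κ : Y → Z` with
`α = β κ` the morphism `κ` is an isometric isomorphism. As `β` is injective, it is no restriction
to take the Banach module `Z` in the universe of `X`. -/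
def IsMaximalMono (𝕜 : Type*) [RCLike 𝕜] {A : Type u} [NormedRing A] [NormedAlgebra 𝕜 A]
    {Y : Type v} [NormedAddCommGroup Y] [Module A Y]
    {X : Type v} [NormedAddCommGroup X] [Module A X] (α : Y →L[A] X) : Prop :=
  IsContractiveMono α ∧ ¬ Function.Surjective α ∧
    ∀ (Z : Type v) [NormedAddCommGroup Z] [NormedSpace 𝕜 Z] [CompleteSpace Z]
      [Module A Z] [IsScalarTower 𝕜 A Z] [IsBoundedSMul A Z]
      (β : Z →L[A] X) (κ : Y →L[A] Z),
      IsContractiveMono β → ¬ Function.Surjective β → IsContractive κ → α = β.comp κ →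
        Isometry κ ∧ Function.Surjective κ

/-- A morphism `ψ : X₀ → X` of Banach modules is small if every morphism `φ : Y → X` for which
`Y ⊕ X₀ → X, (y, z) ↦ φ y + ψ z` is surjective is itself surjective. Only the range of `φ`
matters, and every `φ` has the range of the injective morphism that it induces on
`Y ⧸ ker φ`, so it is no restriction to take `Y` in the universe of `X`. -/
def IsSmall (𝕜 : Type*) [RCLike 𝕜] {A : Type u} [NormedRing A] [NormedAlgebra 𝕜 A]
    {X₀ : Type v} [NormedAddCommGroup X₀] [Module A X₀]
    {X : Type v} [NormedAddCommGroup X] [Module A X] (ψ : X₀ →L[A] X) : Prop :=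
  ∀ (Y : Type v) [NormedAddCommGroup Y] [NormedSpace 𝕜 Y] [CompleteSpace Y]
    [Module A Y] [IsScalarTower 𝕜 A Y] [IsBoundedSMul A Y] (φ : Y →L[A] X),
    Function.Surjective (φ.coprod ψ) → Function.Surjective φ

/-- The topological radical from outside: the intersection of the ranges of all maximal
contractive monomorphisms from Banach `A`-modules to `X`. -/
def trad (𝕜 : Type*) [RCLike 𝕜] (A : Type u) [NormedRing A] [NormedAlgebra 𝕜 A]
    (X : Type v) [NormedAddCommGroup X] [Module A X] : Submodule A X :=
  sInf {S : Submodule A X | ∃ (Y : Type v) (_ : NormedAddCommGroup Y) (_ : NormedSpace 𝕜 Y)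
    (_ : CompleteSpace Y) (_ : Module A Y) (_ : IsScalarTower 𝕜 A Y) (_ : IsBoundedSMul A Y)
    (α : Y →L[A] X), IsMaximalMono 𝕜 α ∧ S = LinearMap.range (α : Y →ₗ[A] X)}

/-- The topological radical from inside: the union of the ranges of all small morphisms from
Banach `A`-modules to `X`. -/
def smallUnion (𝕜 : Type*) [RCLike 𝕜] (A : Type u) [NormedRing A] [NormedAlgebra 𝕜 A]
    (X : Type v) [NormedAddCommGroup X] [Module A X] : Set X :=
  {x : X | ∃ (X₀ : Type v) (_ : NormedAddCommGroup X₀) (_ : NormedSpace 𝕜 X₀)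
    (_ : CompleteSpace X₀) (_ : Module A X₀) (_ : IsScalarTower 𝕜 A X₀) (_ : IsBoundedSMul A X₀)
    (ψ : X₀ →L[A] X), IsSmall 𝕜 ψ ∧ x ∈ Set.range ψ}

end BanachModule

namespace BanachModule

open Topology

/-! Surjectivity of a bounded map `A^n → X` survives small perturbations of the generators, so a
dense submodule of a finitely generated `X` is all of `X`, and maximal submodules are closed
(`isClosed_of_isCoatom`). They are thus Banach modules, and their inclusions can compete in the
definitions of maximal and small morphisms. Since every proper submodule of `X` lies in a maximal
one, the ranges of maximal contractive monomorphisms are exactly the maximal submodules, and the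
radical, being closed, is itself the range of the largest small morphism. -/

instance Submodule.isBoundedSMul_coe {A : Type u} [NormedRing A] {X : Type v}
    [NormedAddCommGroup X] [Module A X] [IsBoundedSMul A X] (M : Submodule A X) :
    IsBoundedSMul A M :=
  .of_norm_smul_le fun a x => norm_smul_le a (x : X)

/-- The inclusion of a maximal submodule is a maximal contractive monomorphism. -/
theorem isMaximalMono_subtypeL (𝕜 : Type w) [RCLike 𝕜] {A : Type u} [NormedRing A]
    [NormedAlgebra 𝕜 A] {X : Type v} [NormedAddCommGroup X] [Module A X] {M : Submodule A X}
    (hM : IsCoatom M) : IsMaximalMono 𝕜 M.subtypeL := by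
  refine ⟨⟨fun _ => le_rfl, M.injective_subtype⟩, fun h => hM.1 ?_, ?_⟩
  · rw [← M.range_subtype]
    exact LinearMap.range_eq_top.2 h
  intro Z _ _ _ _ _ _ β κ hβ hβs hκ hcomp
  have hfac : ∀ y : M, β (κ y) = y := fun y => (DFunLike.congr_fun hcomp y).symm
  have hle : M ≤ LinearMap.range (β : Z →ₗ[A] X) := fun y hy => ⟨κ ⟨y, hy⟩, hfac ⟨y, hy⟩⟩
  have hrange : LinearMap.range (β : Z →ₗ[A] X) = M :=
    (hM.le_iff.1 hle).resolve_left fun h => hβs (LinearMap.range_eq_top.1 h)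
  -- The inclusion preserves norms and factors through the contraction `β`, so `κ` cannot shrink any
  -- vector.
  refine ⟨AddMonoidHomClass.isometry_of_norm κ fun y => le_antisymm (hκ y) ?_, fun z => ?_⟩
  · calc ‖y‖ = ‖β (κ y)‖ := by rw [hfac]; rfl
      _ ≤ ‖κ y‖ := hβ.1 _
  · have hz : β z ∈ M := hrange ▸ LinearMap.mem_range_self (β : Z →ₗ[A] X) z
    exact ⟨⟨β z, hz⟩, hβ.2 (hfac ⟨β z, hz⟩)⟩

/-- The inclusion of the algebraic radical into a finitely generated module is small. -/
theorem isSmall_subtypeL_jacobson (𝕜 : Type w) [RCLike 𝕜] {A : Type u} [NormedRing A]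
    [NormedAlgebra 𝕜 A] {X : Type v} [NormedAddCommGroup X] [Module A X] [Module.Finite A X] :
    IsSmall 𝕜 (Module.jacobson A X).subtypeL := by
  intro Y _ _ _ _ _ _ φ hφ
  refine LinearMap.range_eq_top.1 ((eq_top_or_exists_le_coatom
    (LinearMap.range (φ : Y →ₗ[A] X))).resolve_right ?_)
  rintro ⟨M, hM, hle⟩
  refine hM.1 (eq_top_iff.2 fun x _ => ?_)
  obtain ⟨⟨y, z⟩, rfl⟩ := hφ x
  exact M.add_mem (hle (LinearMap.mem_range_self (φ : Y →ₗ[A] X) y)) (Submodule.mem_sInf.1 z.2 M hM)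

section

variable {A : Type u} [NormedRing A] [CompleteSpace A] {X : Type v} [NormedAddCommGroup X]
  [CompleteSpace X] [Module A X] [IsBoundedSMul A X]

/-- A dense submodule of a finitely generated Banach module is everything: replacing generators
by nearby elements of the submodule perturbs an open map from a free module only slightly. -/
theorem eq_top_of_dense_of_finite (𝕜 : Type w) [RCLike 𝕜] [NormedAlgebra 𝕜 A]
    [NormedSpace 𝕜 X] [IsScalarTower 𝕜 A X] [Module.Finite A X] {M : Submodule A X}
    (hM : Dense (M : Set X)) : M = ⊤ := by
  obtain ⟨n, x, hx⟩ := (Submodule.fg_iff_exists_fin_generating_family (N := (⊤ : Submodule A X))).1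
    Module.Finite.fg_top
  let S : (Fin n → A) →L[𝕜] X :=
    { toLinearMap := (Fintype.linearCombination A x).restrictScalars 𝕜
      cont := by
        change Continuous fun a : Fin n → A => Fintype.linearCombination A x a
        simp only [Fintype.linearCombination_apply]
        fun_prop }
  have hS : S.range = ⊤ := by
    refine LinearMap.range_eq_top.2 fun y => ?_
    have hy : y ∈ LinearMap.range (Fintype.linearCombination A x) := by
      rw [Fintype.range_linearCombination, hx]
      trivial
    exact hy
  set g := S.nonlinearRightInverseOfSurjective hS
  have hg : 0 < g.nnnorm := S.nonlinearRightInverseOfSurjective_nnnorm_pos hS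
  -- Any positive constant below `g.nnnorm⁻¹` keeps the perturbed map open.
  set c : NNReal := g.nnnorm⁻¹ / 2
  have hc : 0 < c := by positivity
  -- The `n` errors add up to at most `c`; dividing by `n + 1` also covers `n = 0`.
  have hδ : (0 : ℝ) < c / (n + 1) := by positivity
  choose m hmM hm using fun i => hM.exists_dist_lt (x i) hδ
  have happrox : ApproximatesLinearOn (Fintype.linearCombination A m) S Set.univ c := by
    intro a _ b _
    have key : Fintype.linearCombination A m a - Fintype.linearCombination A m b - S (a - b)
        = ∑ i, (a i - b i) • (m i - x i) := by
      change _ - _ - Fintype.linearCombination A x (a - b) = _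
      simp only [Fintype.linearCombination_apply, ← Finset.sum_sub_distrib, Pi.sub_apply, smul_sub,
        sub_smul]
    rw [key]
    calc ‖∑ i, (a i - b i) • (m i - x i)‖
        ≤ ∑ _i : Fin n, ‖a - b‖ * (c / (n + 1)) := by
          refine norm_sum_le_of_le _ fun i _ => (norm_smul_le _ _).trans ?_
          refine mul_le_mul (norm_le_pi_norm (a - b) i) ?_ (norm_nonneg _) (norm_nonneg _)
          rw [← dist_eq_norm, dist_comm]
          exact (hm i).le
      _ = (n / (n + 1) : ℝ) * (c * ‖a - b‖) := by
          rw [Finset.sum_const, Finset.card_univ, Fintype.card_fin, nsmul_eq_mul]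
          ring
      _ ≤ c * ‖a - b‖ := by
          refine mul_le_of_le_one_left (by positivity) ?_
          rw [div_le_one (by positivity)]
          linarith
  -- The perturbed map takes values in `M` and its range is a neighbourhood of `0`, so `M` has an
  -- interior point.
  have hnhds : (M : Set X) ∈ 𝓝 (Fintype.linearCombination A m 0) := by
    refine Filter.mem_of_superset (happrox.image_mem_nhds g Filter.univ_mem
      (Or.inr (NNReal.half_lt_self (by positivity)))) ?_
    rintro _ ⟨a, -, rfl⟩
    rw [Fintype.linearCombination_apply]
    exact M.sum_mem fun i _ => M.smul_mem _ (hmM i)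
  have htop := (M.restrictScalars 𝕜).eq_top_of_nonempty_interior'
    ⟨_, mem_interior_iff_mem_nhds.2 hnhds⟩
  exact (Submodule.restrictScalars_eq_top_iff 𝕜 A X).1 htop

/-- By maximality the closure is either the submodule itself or everything, and density is excluded.
-/
theorem isClosed_of_isCoatom (𝕜 : Type w) [RCLike 𝕜] [NormedAlgebra 𝕜 A]
    [NormedSpace 𝕜 X] [IsScalarTower 𝕜 A X] [Module.Finite A X] {M : Submodule A X}
    (hM : IsCoatom M) : IsClosed (M : Set X) := by
  rcases hM.le_iff.1 M.le_topologicalClosure with h | h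
  · refine absurd (eq_top_of_dense_of_finite 𝕜 ?_) hM.1
    rw [dense_iff_closure_eq, ← Submodule.topologicalClosure_coe, h, Submodule.top_coe]
  · rw [← h]
    exact M.isClosed_topologicalClosure

/-- The range of a maximal contractive monomorphism into a finitely generated Banach module is
a maximal submodule. -/
theorem IsMaximalMono.isCoatom_range {𝕜 : Type w} [RCLike 𝕜] [NormedAlgebra 𝕜 A]
    [NormedSpace 𝕜 X] [IsScalarTower 𝕜 A X] [Module.Finite A X] {Y : Type v} [NormedAddCommGroup Y]
    [Module A Y] {α : Y →L[A] X} (hα : IsMaximalMono 𝕜 α) :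
    IsCoatom (LinearMap.range (α : Y →ₗ[A] X)) := by
  obtain ⟨hmono, hsurj, hmax⟩ := hα
  obtain ⟨M, hM, hle⟩ := (eq_top_or_exists_le_coatom (LinearMap.range (α : Y →ₗ[A] X))).resolve_left
    fun h => hsurj (LinearMap.range_eq_top.1 h)
  have hmem : ∀ y, α y ∈ M := fun y => hle (LinearMap.mem_range_self (α : Y →ₗ[A] X) y)
  have : CompleteSpace M := (isClosed_of_isCoatom 𝕜 hM).completeSpace_coe
  have hι := isMaximalMono_subtypeL 𝕜 hM
  -- Maximality of `α`, tested against the inclusion of `M`, leaves no gap between its range and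
  -- `M`.
  obtain ⟨-, hκ⟩ := hmax M M.subtypeL (α.codRestrict M hmem) hι.1 hι.2.1 hmono.1 rfl
  have hrange : LinearMap.range (α : Y →ₗ[A] X) = M := by
    refine le_antisymm hle fun x hx => ?_
    obtain ⟨y, hy⟩ := hκ ⟨x, hx⟩
    exact ⟨y, congrArg Subtype.val hy⟩
  rwa [hrange]

theorem trad_eq_jacobson (𝕜 : Type w) [RCLike 𝕜] [NormedAlgebra 𝕜 A]
    [NormedSpace 𝕜 X] [IsScalarTower 𝕜 A X] [Module.Finite A X] :
    trad 𝕜 A X = Module.jacobson A X := by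
  refine congrArg sInf (Set.ext fun M => ⟨?_, fun hM => ?_⟩)
  · rintro ⟨Y, _, _, _, _, _, _, α, hα, rfl⟩
    exact hα.isCoatom_range
  · have : CompleteSpace M := (isClosed_of_isCoatom 𝕜 hM).completeSpace_coe
    exact ⟨M, inferInstance, inferInstance, inferInstance, inferInstance, inferInstance,
      inferInstance, M.subtypeL, isMaximalMono_subtypeL 𝕜 hM, M.range_subtype.symm⟩

theorem isClosed_jacobson (𝕜 : Type w) [RCLike 𝕜] [NormedAlgebra 𝕜 A]
    [NormedSpace 𝕜 X] [IsScalarTower 𝕜 A X] [Module.Finite A X] :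
    IsClosed (Module.jacobson A X : Set X) := by
  rw [Module.jacobson, Submodule.coe_sInf]
  exact isClosed_biInter fun M hM => isClosed_of_isCoatom 𝕜 hM

/-- The range of a small morphism into a finitely generated Banach module lies in the algebraic
radical. -/
theorem IsSmall.mem_jacobson {𝕜 : Type w} [RCLike 𝕜] [NormedAlgebra 𝕜 A]
    [NormedSpace 𝕜 X] [IsScalarTower 𝕜 A X] [Module.Finite A X] {X₀ : Type v} [NormedAddCommGroup X₀]
    [Module A X₀] {ψ : X₀ →L[A] X} (hψ : IsSmall 𝕜 ψ) (z : X₀) : ψ z ∈ Module.jacobson A X := by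
  refine Submodule.mem_sInf.2 fun M hM => ?_
  by_contra hz
  have : CompleteSpace M := (isClosed_of_isCoatom 𝕜 hM).completeSpace_coe
  refine (isMaximalMono_subtypeL 𝕜 hM).2.1 (hψ M M.subtypeL fun x => ?_)
  -- If the range of `ψ` escapes `M`, the two span `X`, and smallness would make the inclusion of
  -- `M` surjective.
  have hsup : M ⊔ LinearMap.range (ψ : X₀ →ₗ[A] X) = ⊤ := by
    refine hM.2 _ (left_lt_sup.2 fun h => hz (h ⟨z, rfl⟩))
  obtain ⟨y, hy, _, ⟨t, rfl⟩, rfl⟩ := Submodule.mem_sup.1 (hsup ▸ Submodule.mem_top : x ∈ _)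
  exact ⟨(⟨y, hy⟩, t), rfl⟩

theorem smallUnion_eq_jacobson (𝕜 : Type w) [RCLike 𝕜] [NormedAlgebra 𝕜 A]
    [NormedSpace 𝕜 X] [IsScalarTower 𝕜 A X] [Module.Finite A X] :
    smallUnion 𝕜 A X = (Module.jacobson A X : Set X) := by
  ext x
  constructor
  · rintro ⟨X₀, _, _, _, _, _, _, ψ, hψ, z, rfl⟩
    exact hψ.mem_jacobson z
  · intro hx
    have : CompleteSpace (Module.jacobson A X) := (isClosed_jacobson 𝕜).completeSpace_coe
    exact ⟨Module.jacobson A X, inferInstance, inferInstance, inferInstance, inferInstance,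
      inferInstance, inferInstance, (Module.jacobson A X).subtypeL, isSmall_subtypeL_jacobson 𝕜,
      ⟨x, hx⟩, rfl⟩

end

end BanachModule

theorem mainTheorem5 {𝕜 : Type w} [RCLike 𝕜] {A : Type u} [NormedRing A] [NormedAlgebra 𝕜 A]
    [CompleteSpace A] :
    (∀ (X : Type v) [NormedAddCommGroup X] [NormedSpace 𝕜 X] [CompleteSpace X]
      [Module A X] [IsScalarTower 𝕜 A X] [IsBoundedSMul A X], Module.Finite A X →
        (∀ M : Submodule A X, IsCoatom M → IsClosed (M : Set X)) ∧
        BanachModule.trad 𝕜 A X = Module.jacobson A X ∧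
        BanachModule.smallUnion 𝕜 A X = (Module.jacobson A X : Set X)) ∧
    BanachModule.trad 𝕜 A A = Ring.jacobson A ∧
    BanachModule.smallUnion 𝕜 A A = (Ring.jacobson A : Set A) := by
  refine ⟨fun X _ _ _ _ _ _ _ => ⟨fun M hM => BanachModule.isClosed_of_isCoatom 𝕜 hM,
    BanachModule.trad_eq_jacobson 𝕜, BanachModule.smallUnion_eq_jacobson 𝕜⟩,
    -- `Ring.jacobson A` is by definition `Module.jacobson A A`, and `A` is generated by `1`.
    BanachModule.trad_eq_jacobson 𝕜, BanachModule.smallUnion_eq_jacobson 𝕜⟩
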